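/- Let $d\ge 0$, $n=(n_1,\dots,n_d)\in\mathbb N_0^d$, $|n|=n_1+\dots+n_d$, and for $z\in\mathbb C^d$ let $Z_n=\bigoplus_{i=1}^d z_iI_{n_i}$. Let $K$ be a complex $|n|\times|n|$ matrix with $\|K\|\le 1$ (operator norm), and let $p\in\mathbb C[z_1,\dots,z_d]$ be the polynomial $p(z)=\det(I-KZ_n)$. Write $\bar p(z)=\overline{p(\bar z)}$, $\mathbb D^d=\{z\in\mathbb C^d:|z_i|<1 \text{ for all } i\}$, and $\deg p=(\deg_1p,\dots,\deg_dp)$, where $\deg_i p$ is the degree of $p$ in $z_i$. The polynomial $p$ is semi-stable if it has no zeros in $\mathbb D^d$. The (scalar) Schur--Agler class consists of the analytic functions $f(z)=\sum_k c_kz^k$ on $\mathbb D^d$ with $\|f(T)\|\le 1$, $f(T)=\sum_kc_kT^k$, for all $d$-tuples $T$ of commuting strict contractions on a common complex Hilbert space. For $m\in\mathbb N_0^d$, a semi-stable polynomial $p$ is an eventual Agler denominator of order $m$ if $\deg p\le m$ componentwise and $z^m\bar p(1/z)/p(z)$ is in the Schur--Agler class; it is an Agler denominator if this holds with $m=\deg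 p$. Then $\deg p\le n$, so that $z^n\bar p(1/z)$ is a polynomial, and $$\frac{z^n\bar p(1/z)}{p(z)}=\det\left(-K^*+\sqrt{I-K^*K}\,Z_n(I-KZ_n)^{-1}\sqrt{I-KK^*}\right)$$ for all $z\in\mathbb C^d$ with $p(z)\ne 0$. The function $z^n\bar p(1/z)/p(z)$ is rational inner on $\mathbb D^d$ (analytic and bounded by $1$ there, with radial limits that exist and are unimodular almost everywhere on the $d$-torus), and $p$ is an eventual Agler denominator of order $n$; in particular this rational inner function lies in the Schur--Agler class. If $\deg p=n$, then $p$ is an Agler denominator. -/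

import Mathlib

open scoped MatrixOrder

universe u

/-- The open unit polydisk in `ℂ^d`. -/
def polydisk (d : ℕ) : Set (Fin d → ℂ) := {z | ∀ i, ‖z i‖ < 1}

/-- The diagonal matrix `Z_n = ⨁ᵢ zᵢ I_{nᵢ}` over a commutative ring; its rows and columns are
indexed by the `|n| = n₁ + ⋯ + n_d` pairs `(i, j)` with `j < nᵢ`. -/
def blockDiag {d : ℕ} {R : Type*} [CommRing R] (n : Fin d → ℕ) (z : Fin d → R) :
    Matrix (Σ i, Fin (n i)) (Σ i, Fin (n i)) R :=
  Matrix.diagonal fun a => z a.1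

/-- The polynomial `det (I - K Z_n)` in `ℂ[z₁, …, z_d]`. -/
noncomputable def detRep {d : ℕ} (n : Fin d → ℕ)
    (K : Matrix (Σ i, Fin (n i)) (Σ i, Fin (n i)) ℂ) : MvPolynomial (Fin d) ℂ :=
  (1 - K.map MvPolynomial.C * blockDiag n MvPolynomial.X).det

/-- A complex square matrix is a contraction if its operator norm with respect to the Euclidean
norm is at most one. -/
def IsContraction {ι : Type*} [Fintype ι] [DecidableEq ι] (K : Matrix ι ι ℂ) : Prop :=
  ‖Matrix.toEuclideanCLM (𝕜 := ℂ) K‖ ≤ 1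

/-- The matrix `-K* + √(I - K*K) Z_n (I - K Z_n)⁻¹ √(I - KK*)`, with positive semidefinite
square roots. -/
noncomputable def transferMatrix {d : ℕ} (n : Fin d → ℕ)
    (K : Matrix (Σ i, Fin (n i)) (Σ i, Fin (n i)) ℂ) (z : Fin d → ℂ) :
    Matrix (Σ i, Fin (n i)) (Σ i, Fin (n i)) ℂ :=
  -K.conjTranspose + CFC.sqrt (1 - K.conjTranspose * K) * blockDiag n z *
    (1 - K * blockDiag n z)⁻¹ * CFC.sqrt (1 - K * K.conjTranspose)

/-- The multi-degree of a polynomial. -/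
noncomputable def multiDegree {d : ℕ} (p : MvPolynomial (Fin d) ℂ) : Fin d → ℕ :=
  fun i => p.degreeOf i

/-- The polynomial `z^n p̄(1/z) = ∑ₖ conj(pₖ) z^(n-k)`, where `p̄(z) = conj (p (conj z))`. It is
meant for `multiDegree p ≤ n`, see `eval_reflection`. -/
noncomputable def reflection {d : ℕ} (n : Fin d → ℕ) (p : MvPolynomial (Fin d) ℂ) :
    MvPolynomial (Fin d) ℂ :=
  ∑ k ∈ p.support, MvPolynomial.C (star (p.coeff k)) * ∏ i, MvPolynomial.X i ^ (n i - k i)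

theorem eval_reflection {d : ℕ} (n : Fin d → ℕ) (p : MvPolynomial (Fin d) ℂ)
    (hp : multiDegree p ≤ n) (z : Fin d → ℂ) (hz : ∀ i, z i ≠ 0) :
    MvPolynomial.eval z (reflection n p) =
      (∏ i, z i ^ n i) * star (MvPolynomial.eval (fun i => star (1 / z i)) p) := by
  rw [MvPolynomial.eval_eq' (fun i => star (1 / z i)) p, star_sum, Finset.mul_sum, reflection, map_sum]
  refine Finset.sum_congr rfl fun k hk => ?_
  have hkn : ∀ i, k i ≤ n i := fun i => (MvPolynomial.monomial_le_degreeOf i hk).trans (hp i)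
  have h : ∀ i, z i ^ (n i - k i) = z i ^ n i * (1 / z i) ^ k i := fun i => by
    rw [pow_sub₀ _ (hz i) (hkn i), one_div, inv_pow]
  simp only [map_mul, MvPolynomial.eval_C, map_prod, map_pow, MvPolynomial.eval_X, h,
    Finset.prod_mul_distrib, star_mul', star_prod, star_pow, star_star]
  ring

/-- The function `z ↦ z^n p̄(1/z) / p(z)`. -/
noncomputable def reflectionQuotient {d : ℕ} (n : Fin d → ℕ) (p : MvPolynomial (Fin d) ℂ)
    (z : Fin d → ℂ) : ℂ :=
  MvPolynomial.eval z (reflection n p) / MvPolynomial.eval z p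

/-- A polynomial is semi-stable if it has no zeros in the open polydisk. -/
def IsSemiStable {d : ℕ} (p : MvPolynomial (Fin d) ℂ) : Prop :=
  ∀ z ∈ polydisk d, MvPolynomial.eval z p ≠ 0

/-- `T^k = T₁^{k₁} ⋯ T_d^{k_d}` for a tuple of (commuting) operators. -/
noncomputable def operatorPow {d : ℕ} {H : Type u} [NormedAddCommGroup H] [InnerProductSpace ℂ H]
    (T : Fin d → H →L[ℂ] H) (k : Fin d → ℕ) : H →L[ℂ] H :=
  (List.ofFn fun i => T i ^ k i).prod

/-- The scalar Schur–Agler class: `f` is analytic on the polydisk and `‖f(T)‖ ≤ 1` for every tuple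
`T` of commuting strict contractions on a common Hilbert space. Here `f(T) = ∑ₖ cₖ T^k`, where
`f(z) = ∑ₖ cₖ z^k` is the (unique) power series of `f` on the polydisk. -/
def IsSchurAgler {d : ℕ} (f : (Fin d → ℂ) → ℂ) : Prop :=
  AnalyticOnNhd ℂ f (polydisk d) ∧
  ∃ c : (Fin d → ℕ) → ℂ,
    (∀ z ∈ polydisk d, HasSum (fun k => c k * ∏ i, z i ^ k i) (f z)) ∧
    ∀ (H : Type u) [NormedAddCommGroup H] [InnerProductSpace ℂ H] [CompleteSpace H]
      (T : Fin d → H →L[ℂ] H),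
      (∀ i j, Commute (T i) (T j)) → (∀ i, ‖T i‖ < 1) →
        ∃ A : H →L[ℂ] H, HasSum (fun k => c k • operatorPow T k) A ∧ ‖A‖ ≤ 1

/-- A rational inner function on the polydisk: a rational function, analytic and bounded by one on
the polydisk, whose radial limits exist and are unimodular almost everywhere on the torus
(parametrised by angles). -/
def IsRationalInner {d : ℕ} (f : (Fin d → ℂ) → ℂ) : Prop :=
  (∃ a b : MvPolynomial (Fin d) ℂ, ∀ z ∈ polydisk d,
    MvPolynomial.eval z b ≠ 0 ∧ f z = MvPolynomial.eval z a / MvPolynomial.eval z b) ∧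
  AnalyticOnNhd ℂ f (polydisk d) ∧
  (∀ z ∈ polydisk d, ‖f z‖ ≤ 1) ∧
  ∀ᵐ θ : Fin d → ℝ, ∃ w : ℂ, ‖w‖ = 1 ∧
    Filter.Tendsto (fun r : ℝ => f fun i => r * Complex.exp (θ i * Complex.I))
      (nhdsWithin 1 (Set.Iio 1)) (nhds w)

/-- `p` is an eventual Agler denominator of order `n`: it is semi-stable and `z^n p̄(1/z) / p(z)`
is in the Schur–Agler class. (Since `p(0) ≠ 0`, analyticity of this quotient on the polydisk
forces `multiDegree p ≤ n`; this is recorded so that `reflection n p` is `z^n p̄(1/z)`.) -/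
def IsEventualAglerDenominator {d : ℕ} (n : Fin d → ℕ) (p : MvPolynomial (Fin d) ℂ) : Prop :=
  IsSemiStable p ∧ multiDegree p ≤ n ∧ IsSchurAgler.{u} (reflectionQuotient n p)

/-- `p` is an Agler denominator: it is semi-stable and `z^(deg p) p̄(1/z) / p(z)` is in the
Schur–Agler class. -/
def IsAglerDenominator {d : ℕ} (p : MvPolynomial (Fin d) ℂ) : Prop :=
  IsSemiStable p ∧ IsSchurAgler.{u} (reflectionQuotient (multiDegree p) p)

/-!
Write `F(Z) = -K* + √(I - K*K) Z (I - KZ)⁻¹ √(I - KK*)`. A Schur complement in the block matrix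
`[I - KZ, √(I - KK*); -√(I - K*K) Z, -K*]` gives `det (I - KZ) · det F(Z) = det (Z - K*)`: if the
defect operators are invertible the block matrix factors explicitly, and the general case follows
by letting `t → 1` in `tK`. For `Z = Z_n` the right-hand side is `z^n p̄(1/z)`.

The Julia matrix `[√(I - KK*), K; -K*, √(I - K*K)]` is unitary and maps `(v, Zx)` to `(x, F(Z)v)`
for `x = (I - KZ)⁻¹ √(I - KK*) v`. Hence `F(Z)` acts contractively whenever `Z` does, also if the
variables of `Z_n` are replaced by commuting contractions on a Hilbert space. The determinant of a
contractive `m × m` matrix `F` with commuting entries is again a contraction: `F ⊗ ⋯ ⊗ F` (`m`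
factors) is contractive, and it multiplies the alternating tensor by `det F`.

To substitute operators into `det F(Z_n)` as a power series one needs its convergence on the
polydisk. Multiplication by a variable is isometric on the homogeneous components of formal power
series, so the coefficients of `(I - KZ_n)⁻¹` are bounded by one.
-/

section Defect

open Matrix
open scoped ComplexOrder Matrix.Norms.L2Operator

variable {ι κ : Type*} [Fintype ι] [DecidableEq ι] [Fintype κ] [DecidableEq κ]

theorem fromBlocks_zero_zero_nonneg {ι κ : Type*} [Finite ι] [Finite κ] {A : Matrix ι ι ℂ}
    {B : Matrix κ κ ℂ} (hA : 0 ≤ A) (hB : 0 ≤ B) : 0 ≤ fromBlocks A 0 0 B := by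
  classical
  cases nonempty_fintype ι
  cases nonempty_fintype κ
  obtain ⟨E, rfl⟩ := CStarAlgebra.nonneg_iff_eq_star_mul_self.1 hA
  obtain ⟨G, rfl⟩ := CStarAlgebra.nonneg_iff_eq_star_mul_self.1 hB
  have hsq : fromBlocks (star E * E) 0 0 (star G * G) =
      star (fromBlocks E 0 0 G) * fromBlocks E 0 0 G := by
    simp [star_eq_conjTranspose, fromBlocks_conjTranspose, fromBlocks_multiply]
  rw [hsq]
  exact star_mul_self_nonneg _

theorem sqrt_fromBlocks_zero_zero {A : Matrix ι ι ℂ} {B : Matrix κ κ ℂ} (hA : 0 ≤ A)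
    (hB : 0 ≤ B) :
    CFC.sqrt (fromBlocks A 0 0 B) = fromBlocks (CFC.sqrt A) 0 0 (CFC.sqrt B) := by
  refine CFC.sqrt_unique ?_ (fromBlocks_zero_zero_nonneg (CFC.sqrt_nonneg A) (CFC.sqrt_nonneg B))
  simp [fromBlocks_multiply, CFC.sqrt_mul_sqrt_self A hA, CFC.sqrt_mul_sqrt_self B hB]

/- `A X = X B` says that the off-diagonal block matrix `X` commutes with `A ⊕ B`, hence with its
square root. -/
theorem mul_sqrt_eq_sqrt_mul {A : Matrix ι ι ℂ} {B : Matrix κ κ ℂ} {X : Matrix ι κ ℂ}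
    (hA : 0 ≤ A) (hB : 0 ≤ B) (h : A * X = X * B) : X * CFC.sqrt B = CFC.sqrt A * X := by
  have hcomm : Commute (fromBlocks A 0 0 B) (fromBlocks 0 X 0 0) := by
    simp [commute_iff_eq, fromBlocks_multiply, h]
  have hsqrt := hcomm.cfcₙ_nnreal NNReal.sqrt
  change Commute (CFC.sqrt _) _ at hsqrt
  rw [sqrt_fromBlocks_zero_zero hA hB, commute_iff_eq, fromBlocks_multiply,
    fromBlocks_multiply] at hsqrt
  simpa using (fromBlocks_inj.1 hsqrt).2.1.symm

/-- The defect operator `√(I - K*K)`, measuring how far `K` is from being isometric. -/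
noncomputable def defect (K : Matrix ι ι ℂ) : Matrix ι ι ℂ := CFC.sqrt (1 - Kᴴ * K)

theorem conjTranspose_defect (K : Matrix ι ι ℂ) : (defect K)ᴴ = defect K :=
  (nonneg_iff_posSemidef.1 (CFC.sqrt_nonneg (1 - Kᴴ * K))).isHermitian

namespace IsContraction

variable {K : Matrix ι ι ℂ}

theorem conjTranspose (hK : IsContraction K) : IsContraction Kᴴ :=
  (l2_opNorm_conjTranspose K).trans_le hK

theorem sum_norm_sq_mulVec_le (hK : IsContraction K) (v : ι → ℂ) :
    ∑ a, ‖(K *ᵥ v) a‖ ^ 2 ≤ ∑ a, ‖v a‖ ^ 2 := by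
  have h := (toEuclideanCLM (𝕜 := ℂ) K).le_of_opNorm_le hK (WithLp.toLp 2 v)
  rw [one_mul, toEuclideanCLM_toLp] at h
  simpa only [EuclideanSpace.norm_sq_eq] using pow_le_pow_left₀ (norm_nonneg _) h 2

theorem one_sub_conjTranspose_mul_nonneg (hK : IsContraction K) : 0 ≤ 1 - Kᴴ * K := by
  refine sub_nonneg.2 ((CStarAlgebra.norm_le_one_iff_of_nonneg _ (star_mul_self_nonneg K)).1 ?_)
  rw [CStarRing.norm_star_mul_self]
  exact mul_le_one₀ hK (norm_nonneg K) hK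

theorem defect_mul_defect (hK : IsContraction K) : defect K * defect K = 1 - Kᴴ * K :=
  CFC.sqrt_mul_sqrt_self _ hK.one_sub_conjTranspose_mul_nonneg

theorem defect_conjTranspose_mul_defect_conjTranspose (hK : IsContraction K) :
    defect Kᴴ * defect Kᴴ = 1 - K * Kᴴ := by
  simpa using hK.conjTranspose.defect_mul_defect

theorem mul_defect (hK : IsContraction K) : K * defect K = defect Kᴴ * K :=
  mul_sqrt_eq_sqrt_mul hK.conjTranspose.one_sub_conjTranspose_mul_nonneg
    hK.one_sub_conjTranspose_mul_nonneg (by simp [sub_mul, mul_sub, mul_assoc])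

theorem conjTranspose_mul_defect (hK : IsContraction K) :
    Kᴴ * defect Kᴴ = defect K * Kᴴ := by
  simpa using hK.conjTranspose.mul_defect

theorem det_defect_conjTranspose (hK : IsContraction K) :
    (defect Kᴴ).det = (defect K).det := by
  rw [defect, defect,
    (nonneg_iff_posSemidef.1 hK.one_sub_conjTranspose_mul_nonneg).det_sqrt,
    (nonneg_iff_posSemidef.1 hK.conjTranspose.one_sub_conjTranspose_mul_nonneg).det_sqrt,
    conjTranspose_conjTranspose, det_one_sub_mul_comm]

end IsContraction

theorem continuousOn_defect : ContinuousOn (defect (ι := ι)) {K | IsContraction K} :=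
  CFC.continuousOn_sqrt.comp (by fun_prop) fun _ hK => hK.one_sub_conjTranspose_mul_nonneg

/-- The Julia matrix of `K`, the unitary dilation of a contraction by its defect operators. -/
noncomputable def juliaMatrix (K : Matrix ι ι ℂ) : Matrix (ι ⊕ ι) (ι ⊕ ι) ℂ :=
  fromBlocks (defect Kᴴ) K (-Kᴴ) (defect K)

theorem IsContraction.conjTranspose_juliaMatrix_mul_self {K : Matrix ι ι ℂ}
    (hK : IsContraction K) : (juliaMatrix K)ᴴ * juliaMatrix K = 1 := by
  rw [juliaMatrix, fromBlocks_conjTranspose, fromBlocks_multiply, conjTranspose_defect,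
    conjTranspose_defect, conjTranspose_neg, conjTranspose_conjTranspose,
    hK.defect_conjTranspose_mul_defect_conjTranspose, hK.defect_mul_defect,
    hK.conjTranspose_mul_defect, ← hK.mul_defect, ← fromBlocks_one]
  simp

end Defect

section JuliaTransform

open Matrix
open scoped Matrix.Norms.L2Operator

theorem map_algHom_map_algebraMap {ι κ R S S' : Type*} [CommSemiring R] [Semiring S] [Algebra R S]
    [Semiring S'] [Algebra R S'] (f : S →ₐ[R] S') (A : Matrix ι κ R) :
    (A.map (algebraMap R S)).map f = A.map (algebraMap R S') := by
  simp [Matrix.map_map, Function.comp_def]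

variable {ι : Type*} [Fintype ι] [DecidableEq ι]

/-- The linear fractional transform `-K* + √(I - K*K) Z (I - KZ)⁻¹ √(I - KK*)` of a matrix `Z` over
a commutative `ℂ`-algebra. The algebra is `ℂ` for the values of the transfer function of `K` and a
ring of power series for its Taylor expansion. -/
noncomputable def juliaTransform {S : Type*} [CommRing S] [Algebra ℂ S] (K : Matrix ι ι ℂ)
    (Z : Matrix ι ι S) : Matrix ι ι S :=
  (-Kᴴ).map (algebraMap ℂ S) + (defect K).map (algebraMap ℂ S) * Z *
    (1 - K.map (algebraMap ℂ S) * Z)⁻¹ * (defect Kᴴ).map (algebraMap ℂ S)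

theorem transferMatrix_eq_juliaTransform {d : ℕ} (n : Fin d → ℕ)
    (K : Matrix (Σ i, Fin (n i)) (Σ i, Fin (n i)) ℂ) (z : Fin d → ℂ) :
    transferMatrix n K z = juliaTransform K (_root_.blockDiag n z) := by
  simp [transferMatrix, juliaTransform, defect]

theorem map_juliaTransform {S S' : Type*} [CommRing S] [Algebra ℂ S] [CommRing S'] [Algebra ℂ S']
    (f : S →ₐ[ℂ] S') {K : Matrix ι ι ℂ} {Z : Matrix ι ι S}
    (hZ : IsUnit (1 - K.map (algebraMap ℂ S) * Z).det) :
    (juliaTransform K Z).map f = juliaTransform K (Z.map f) := by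
  have hone : (1 : Matrix ι ι S).map f = 1 := Matrix.map_one _ (map_zero f) (map_one f)
  have hresolvent : (1 - K.map (algebraMap ℂ S) * Z)⁻¹.map f =
      (1 - K.map (algebraMap ℂ S') * Z.map f)⁻¹ := by
    refine (inv_eq_right_inv ?_).symm
    have h := congrArg (Matrix.map · f) (mul_nonsing_inv _ hZ)
    simpa only [Matrix.map_mul, Matrix.map_sub _ (map_sub f), map_algHom_map_algebraMap,
      hone] using h
  simp only [juliaTransform, Matrix.map_add _ (map_add f), Matrix.map_mul,
    map_algHom_map_algebraMap, hresolvent]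

/-- A block matrix whose Schur complement is the Julia transform. -/
noncomputable def transferBlocks (K Z : Matrix ι ι ℂ) : Matrix (ι ⊕ ι) (ι ⊕ ι) ℂ :=
  fromBlocks (1 - K * Z) (defect Kᴴ) (-(defect K * Z)) (-Kᴴ)

theorem continuousOn_transferBlocks (Z : Matrix ι ι ℂ) :
    ContinuousOn (transferBlocks · Z) {K | IsContraction K} := by
  have hdefect := continuousOn_iff_continuous_domRestrict.1 (continuousOn_defect (ι := ι))
  have hdefect_star := continuousOn_iff_continuous_domRestrict.1 <|
    continuousOn_defect.comp (f := fun K : Matrix ι ι ℂ => Kᴴ) (by fun_prop)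
      fun _ hK => IsContraction.conjTranspose hK
  exact continuousOn_iff_continuous_domRestrict.2 <| Continuous.matrix_fromBlocks (by fun_prop)
    hdefect_star (hdefect.matrix_mul continuous_const).neg (by fun_prop)

theorem det_transferBlocks_eq_mul_det_juliaTransform {K Z : Matrix ι ι ℂ}
    (hZ : IsUnit (1 - K * Z).det) :
    (transferBlocks K Z).det = (1 - K * Z).det * (juliaTransform K Z).det := by
  have := invertibleOfIsUnitDet _ hZ
  rw [transferBlocks, det_fromBlocks₁₁, invOf_eq_nonsing_inv]
  simp [juliaTransform]

namespace IsContraction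

variable {K : Matrix ι ι ℂ}

theorem det_transferBlocks_of_isUnit_defect (hK : IsContraction K) (hD : IsUnit (defect K).det)
    (Z : Matrix ι ι ℂ) : (transferBlocks K Z).det = (Z - Kᴴ).det := by
  have hfactor : fromBlocks 1 0 Kᴴ (defect K) * transferBlocks K Z =
      fromBlocks (1 - K * Z) 1 (Kᴴ - Z) 0 * fromBlocks 1 0 0 (defect Kᴴ) := by
    have hDDZ : defect K * (defect K * Z) = Z - Kᴴ * (K * Z) := by
      rw [← mul_assoc, hK.defect_mul_defect, sub_mul, one_mul, mul_assoc]
    rw [transferBlocks, fromBlocks_multiply, fromBlocks_multiply]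
    simp [mul_sub, hDDZ, hK.conjTranspose_mul_defect]
  have hcolumns : fromBlocks (1 - K * Z) 1 (Kᴴ - Z) 0 * fromBlocks 1 0 (K * Z) 1 =
      (fromBlocks 1 1 (Kᴴ - Z) 0 : Matrix (ι ⊕ ι) (ι ⊕ ι) ℂ) := by
    simp [fromBlocks_multiply]
  have hdet := congrArg det hfactor
  have hdet' := congrArg det hcolumns
  simp only [det_mul, det_fromBlocks_zero₁₂, det_one, one_mul, mul_one, det_fromBlocks_one₁₁,
    zero_sub, neg_sub, hK.det_defect_conjTranspose] at hdet hdet'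
  rw [hdet', mul_comm] at hdet
  exact hD.mul_right_cancel hdet

theorem isUnit_det_defect (hK : ‖K‖ < 1) : IsUnit (defect K).det := by
  have hunit : IsUnit (1 - Kᴴ * K) := by
    refine isUnit_one_sub_of_norm_lt_one ?_
    rw [l2_opNorm_conjTranspose_mul_self]
    exact mul_lt_one_of_nonneg_of_lt_one_left (norm_nonneg K) hK hK.le
  rw [← defect_mul_defect hK.le, isUnit_iff_isUnit_det, det_mul] at hunit
  exact isUnit_of_mul_isUnit_left hunit

/- Both sides depend continuously on `K`, and the defect operator of `tK` is invertible for
`0 ≤ t < 1`. -/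
theorem det_transferBlocks (hK : IsContraction K) (Z : Matrix ι ι ℂ) :
    (transferBlocks K Z).det = (Z - Kᴴ).det := by
  have hnorm : ∀ t ∈ Set.Icc (0 : ℝ) 1, ‖t • K‖ ≤ t := fun t ht => by
    rw [norm_smul, Real.norm_of_nonneg ht.1]
    exact mul_le_of_le_one_right ht.1 hK
  have hcontr : ∀ t ∈ Set.Icc (0 : ℝ) 1, IsContraction (t • K) := fun t ht =>
    (hnorm t ht).trans ht.2
  have heq : Set.EqOn (fun t : ℝ => (transferBlocks (t • K) Z).det)
      (fun t => (Z - (t • K)ᴴ).det) (Set.Icc 0 1) := by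
    refine Set.EqOn.of_subset_closure (s := Set.Ico 0 1) (fun t ht => ?_) ?_ (by fun_prop)
      Set.Ico_subset_Icc_self (closure_Ico zero_ne_one).ge
    · have hlt := (hnorm t (Set.Ico_subset_Icc_self ht)).trans_lt ht.2
      exact det_transferBlocks_of_isUnit_defect hlt.le (isUnit_det_defect hlt) Z
    · exact continuous_id.matrix_det.comp_continuousOn
        ((continuousOn_transferBlocks Z).comp (by fun_prop) hcontr)
  simpa using heq (Set.right_mem_Icc.2 zero_le_one)

theorem det_one_sub_mul_mul_det_juliaTransform (hK : IsContraction K) {Z : Matrix ι ι ℂ}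
    (hZ : IsUnit (1 - K * Z).det) :
    (1 - K * Z).det * (juliaTransform K Z).det = (Z - Kᴴ).det := by
  rw [← det_transferBlocks_eq_mul_det_juliaTransform hZ, hK.det_transferBlocks]

end IsContraction

end JuliaTransform

section ContractiveAction

open Matrix
open scoped Kronecker

variable {ι κ S H : Type*} [Fintype ι] [Fintype κ] [NormedAddCommGroup H]

/-- A matrix over a ring acting on `H` is contractive if it maps `Hᶥ`, with its `ℓ²` norm,
contractively into itself. -/
def ActsContractively (H : Type*) [NormedAddCommGroup H] [Ring S] [Module S H]
    (M : Matrix ι ι S) : Prop :=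
  ∀ v : ι → H, ∑ a, ‖∑ b, M a b • v b‖ ^ 2 ≤ ∑ a, ‖v a‖ ^ 2

namespace ActsContractively

section Ring

variable [Ring S] [Module S H]

theorem reindex {M : Matrix ι ι S} (hM : ActsContractively H M) (e : ι ≃ κ) :
    ActsContractively H (Matrix.reindex e e M) := fun v => by
  simpa only [reindex_apply, submatrix_apply, ← e.sum_comp, Equiv.symm_apply_apply,
    Function.comp_apply] using hM (v ∘ e)

theorem kronecker {M : Matrix ι ι S} {N : Matrix κ κ S} (hM : ActsContractively H M)
    (hN : ActsContractively H N) : ActsContractively H (M ⊗ₖ N) := fun v =>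
  calc ∑ a, ‖∑ b, (M ⊗ₖ N) a b • v b‖ ^ 2
      = ∑ j, ∑ i, ‖∑ k, M i k • ∑ l, N j l • v (k, l)‖ ^ 2 := by
        simp only [Fintype.sum_prod_type_right, kronecker_apply, mul_smul, Finset.smul_sum]
        exact Finset.sum_congr rfl fun j _ => Finset.sum_congr rfl fun i _ => by
          rw [Finset.sum_comm]
    _ ≤ ∑ j, ∑ k, ‖∑ l, N j l • v (k, l)‖ ^ 2 := Finset.sum_le_sum fun j _ => hM _
    _ = ∑ k, ∑ j, ‖∑ l, N j l • v (k, l)‖ ^ 2 := Finset.sum_comm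
    _ ≤ ∑ k, ∑ j, ‖v (k, j)‖ ^ 2 := Finset.sum_le_sum fun k _ => hN _
    _ = ∑ a, ‖v a‖ ^ 2 := (Fintype.sum_prod_type fun a => ‖v a‖ ^ 2).symm

end Ring

end ActsContractively

/-- The `m`-fold tensor power of a matrix, indexed by tuples. -/
def tensorPower {ι S : Type*} [CommRing S] (m : ℕ) (M : Matrix ι ι S) :
    Matrix (Fin m → ι) (Fin m → ι) S :=
  of fun τ σ => ∏ k, M (τ k) (σ k)

theorem tensorPower_succ {ι S : Type*} [CommRing S] (m : ℕ) (M : Matrix ι ι S) :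
    tensorPower (m + 1) M =
      reindex (Fin.consEquiv fun _ => ι) (Fin.consEquiv fun _ => ι) (M ⊗ₖ tensorPower m M) := by
  ext τ σ
  simp [tensorPower, Fin.prod_univ_succ, Fin.consEquiv, Fin.tail]

theorem ActsContractively.tensorPower [CommRing S] [Module S H] {M : Matrix ι ι S}
    (hM : ActsContractively H M) : ∀ m, ActsContractively H (tensorPower m M)
  | 0 => fun v => by simp [_root_.tensorPower]
  | m + 1 => by
    rw [tensorPower_succ]
    exact (hM.kronecker (hM.tensorPower m)).reindex _

variable [DecidableEq ι]

/-- The Levi-Civita symbol: the sign of `τ` if it is a permutation, and `0` otherwise. These are the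
components of the alternating tensor that is an eigenvector of every tensor power. -/
def leviCivita (τ : ι → ι) : ℤ := ((1 : Matrix ι ι ℤ).submatrix τ id).det

theorem leviCivita_id : leviCivita (id : ι → ι) = 1 := by simp [leviCivita]

variable [CommRing S]

theorem intCast_leviCivita (τ : ι → ι) :
    (leviCivita τ : S) = ((1 : Matrix ι ι S).submatrix τ id).det := by
  rw [leviCivita, Int.cast_det, ← submatrix_map, Matrix.map_one _ Int.cast_zero Int.cast_one]

theorem det_eq_sum_prod_mul_leviCivita (A : Matrix ι ι S) :
    A.det = ∑ σ : ι → ι, (∏ i, A i (σ i)) * leviCivita σ := by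
  have hrows : A = fun i => ∑ j, A i j • (1 : Matrix ι ι S) j := by
    ext i k
    simp [one_apply]
  calc A.det = detRowAlternating.toMultilinearMap fun i => ∑ j, A i j • (1 : Matrix ι ι S) j :=
        congrArg det hrows
    _ = ∑ σ : ι → ι, (∏ i, A i (σ i)) * leviCivita σ := by
        simp only [MultilinearMap.map_sum, MultilinearMap.map_smul_univ, intCast_leviCivita]
        rfl

theorem sum_prod_mul_leviCivita (M : Matrix ι ι S) (τ : ι → ι) :
    ∑ σ : ι → ι, (∏ i, M (τ i) (σ i)) * leviCivita σ = leviCivita τ * M.det := by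
  have hrows : (1 : Matrix ι ι S).submatrix τ id * M = M.submatrix τ id := by
    simpa using (submatrix_mul (1 : Matrix ι ι S) M τ id id Function.bijective_id).symm
  rw [intCast_leviCivita τ, ← det_mul, hrows, det_eq_sum_prod_mul_leviCivita]
  rfl

theorem sum_tensorPower_smul_leviCivita_smul {H : Type*} [AddCommGroup H] [Module S H] {m : ℕ}
    (M : Matrix (Fin m) (Fin m) S) (τ : Fin m → Fin m) (h : H) :
    ∑ σ, tensorPower m M τ σ • leviCivita σ • h = leviCivita τ • M.det • h := by
  simp only [tensorPower, of_apply, ← Int.cast_smul_eq_zsmul S, smul_smul, ← Finset.sum_smul,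
    sum_prod_mul_leviCivita]

theorem ActsContractively.norm_det_smul_le [NormedSpace ℝ H] [Module S H] {M : Matrix ι ι S}
    (hM : ActsContractively H M) (h : H) : ‖M.det • h‖ ≤ ‖h‖ := by
  let e := Fintype.equivFin ι
  have hpos : 0 < ∑ τ : Fin (Fintype.card ι) → Fin (Fintype.card ι), ‖(leviCivita τ : ℝ)‖ ^ 2 :=
    Finset.sum_pos' (fun _ _ => by positivity) ⟨id, Finset.mem_univ _, by simp [leviCivita_id]⟩
  have hle := (hM.reindex e).tensorPower _ fun σ => leviCivita σ • h
  simp only [sum_tensorPower_smul_leviCivita_smul, det_reindex_self, norm_zsmul ℝ, mul_pow,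
    ← Finset.sum_mul] at hle
  exact le_of_sq_le_sq (le_of_mul_le_mul_left hle hpos) (norm_nonneg h)

end ContractiveAction

section Isometry

open Matrix

theorem sum_norm_sq_sum_smul_of_conjTranspose_mul_self {𝕜 ι κ H : Type*} [RCLike 𝕜] [Fintype ι]
    [Fintype κ] [DecidableEq κ] [NormedAddCommGroup H] [InnerProductSpace 𝕜 H] {U : Matrix ι κ 𝕜}
    (hU : Uᴴ * U = 1) (v : κ → H) : ∑ a, ‖∑ b, U a b • v b‖ ^ 2 = ∑ b, ‖v b‖ ^ 2 := by
  have hinner : ∑ a, inner 𝕜 (∑ b, U a b • v b) (∑ b, U a b • v b) = ∑ b, inner 𝕜 (v b) (v b) :=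
    calc ∑ a, inner 𝕜 (∑ b, U a b • v b) (∑ b, U a b • v b)
        = ∑ a, ∑ c, ∑ b, star (U a b) * U a c * inner 𝕜 (v b) (v c) := by
          simp only [sum_inner, inner_sum, inner_smul_left, inner_smul_right, mul_assoc,
            mul_left_comm, starRingEnd_apply, Finset.mul_sum]
      _ = ∑ c, ∑ b, (Uᴴ * U) b c * inner 𝕜 (v b) (v c) := by
          rw [Finset.sum_comm]
          refine Finset.sum_congr rfl fun c _ => ?_
          rw [Finset.sum_comm]
          simp only [mul_apply, Finset.sum_mul, conjTranspose_apply]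
      _ = ∑ b, inner 𝕜 (v b) (v b) := by simp [hU, one_apply]
  simp only [inner_self_eq_norm_sq_to_K] at hinner
  exact_mod_cast hinner

end Isometry

section JuliaContraction

open Matrix
open scoped Matrix.Module

variable {ι S H : Type*} [Fintype ι] [DecidableEq ι] [CommRing S] [Algebra ℂ S]
  [NormedAddCommGroup H] [InnerProductSpace ℂ H] [Module S H] [IsScalarTower ℂ S H]

theorem map_algebraMap_smul_apply (A : Matrix ι ι ℂ) (v : ι → H) (a : ι) :
    (A.map (algebraMap ℂ S) • v) a = ∑ b, A a b • v b := by
  simp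

/-- The vector `(I - KZ)⁻¹ √(I - KK*) v`: the Julia matrix of `K` maps `(v, Zx)` to `(x, Fv)`, where
`x` is this vector and `F` is the Julia transform of `Z`. -/
noncomputable def juliaState (K : Matrix ι ι ℂ) (Z : Matrix ι ι S) (v : ι → H) : ι → H :=
  ((1 - K.map (algebraMap ℂ S) * Z)⁻¹ * (defect Kᴴ).map (algebraMap ℂ S)) • v

theorem juliaMatrix_smul_juliaState {K : Matrix ι ι ℂ} {Z : Matrix ι ι S}
    (hu : IsUnit (1 - K.map (algebraMap ℂ S) * Z).det) (v : ι → H) (a : ι ⊕ ι) :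
    ∑ b, juliaMatrix K a b • Sum.elim v (Z • juliaState K Z v) b =
      Sum.elim (juliaState K Z v) (juliaTransform K Z • v) a := by
  have hstate : (1 - K.map (algebraMap ℂ S) * Z) • juliaState K Z v =
      (defect Kᴴ).map (algebraMap ℂ S) • v := by
    rw [juliaState, ← mul_smul, mul_nonsing_inv_cancel_left _ _ hu]
  have htransform : juliaTransform K Z • v = (-Kᴴ).map (algebraMap ℂ S) • v +
      (defect K).map (algebraMap ℂ S) • Z • juliaState K Z v := by
    simp only [juliaTransform, juliaState, add_smul, mul_smul]
  rw [sub_smul, one_smul, mul_smul, sub_eq_iff_eq_add] at hstate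
  cases a with
  | inl a =>
    rw [Sum.elim_inl, congrFun hstate a, Pi.add_apply, map_algebraMap_smul_apply,
      map_algebraMap_smul_apply]
    simp [juliaMatrix]
  | inr a =>
    rw [Sum.elim_inr, htransform, Pi.add_apply, map_algebraMap_smul_apply,
      map_algebraMap_smul_apply]
    simp [juliaMatrix]

theorem IsContraction.actsContractively_juliaTransform {K : Matrix ι ι ℂ} (hK : IsContraction K)
    {Z : Matrix ι ι S} (hZ : ActsContractively H Z)
    (hu : IsUnit (1 - K.map (algebraMap ℂ S) * Z).det) :
    ActsContractively H (juliaTransform K Z) := fun v => by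
  have hjulia := sum_norm_sq_sum_smul_of_conjTranspose_mul_self
    hK.conjTranspose_juliaMatrix_mul_self (Sum.elim v (Z • juliaState K Z v))
  simp only [juliaMatrix_smul_juliaState hu, Fintype.sum_sum_type, Sum.elim_inl,
    Sum.elim_inr] at hjulia
  have hle : ∑ a, ‖(Z • juliaState K Z v) a‖ ^ 2 ≤ ∑ a, ‖juliaState K Z v a‖ ^ 2 := hZ _
  change ∑ a, ‖(juliaTransform K Z • v) a‖ ^ 2 ≤ _
  linarith

end JuliaContraction

section Polynomials

open MvPolynomial
open Matrix hiding blockDiag blockDiag_map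

theorem map_blockDiag {d : ℕ} (n : Fin d → ℕ) {R S : Type*} [CommRing R] [CommRing S]
    (f : R →+* S) (z : Fin d → R) : (blockDiag n z).map f = blockDiag n fun i => f (z i) :=
  diagonal_map (map_zero f)

theorem det_blockDiag {d : ℕ} (n : Fin d → ℕ) {R : Type*} [CommRing R] (z : Fin d → R) :
    (blockDiag n z).det = ∏ i, z i ^ n i := by
  simp [blockDiag, Fintype.prod_sigma]

theorem map_C_map_eval {σ ι κ R : Type*} [CommRing R] (A : Matrix ι κ R) (z : σ → R) :
    (A.map C).map (eval z) = A := by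
  ext
  simp

theorem degreeOf_det_le {σ R ι : Type*} [CommRing R] [Fintype ι] [DecidableEq ι] (i : σ)
    {M : Matrix ι ι (MvPolynomial σ R)} {c : ι → ℕ} (hM : ∀ a b, degreeOf i (M a b) ≤ c b) :
    degreeOf i M.det ≤ ∑ b, c b := by
  rw [det_apply']
  refine (degreeOf_sum_le _ _ _).trans (Finset.sup_le fun σ _ => ?_)
  have hsign : degreeOf i ((Equiv.Perm.sign σ : ℤ) : MvPolynomial _ R) = 0 := degreeOf_C _ i
  calc _ ≤ 0 + degreeOf i (∏ b, M (σ b) b) := hsign ▸ degreeOf_mul_le i _ _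
    _ ≤ ∑ b, c b := by
      rw [zero_add]
      exact (degreeOf_prod_le i _ _).trans (Finset.sum_le_sum fun b _ => hM (σ b) b)

theorem reflection_eq_of_eval {d : ℕ} {n : Fin d → ℕ} {p q : MvPolynomial (Fin d) ℂ}
    (hp : multiDegree p ≤ n) (h : ∀ z : Fin d → ℂ, (∀ i, z i ≠ 0) →
      eval z q = (∏ i, z i ^ n i) * star (eval (fun i => star (1 / z i)) p)) :
    reflection n p = q :=
  funext_set (fun _ => {0}ᶜ) (fun _ => (Set.finite_singleton _).infinite_compl) fun z hz => by
    have hz : ∀ i, z i ≠ 0 := fun i => hz i trivial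
    rw [eval_reflection n p hp z hz, h z hz]

theorem norm_reflectionQuotient_eq_one {d : ℕ} {n : Fin d → ℕ} {p : MvPolynomial (Fin d) ℂ}
    (hp : multiDegree p ≤ n) {z : Fin d → ℂ} (hz : ∀ i, ‖z i‖ = 1) (h0 : eval z p ≠ 0) :
    ‖reflectionQuotient n p z‖ = 1 := by
  have hz0 : ∀ i, z i ≠ 0 := fun i => norm_ne_zero_iff.1 (by simp [hz i])
  have hstar : (fun i => star (1 / z i)) = z := funext fun i => by
    rw [one_div, Complex.inv_eq_conj (hz i), Complex.star_def, Complex.conj_conj]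
  rw [reflectionQuotient, eval_reflection n p hp z hz0, hstar, norm_div, norm_mul, norm_star,
    norm_prod]
  simp [hz, h0]

section DetRep

variable {d : ℕ} (n : Fin d → ℕ) (K : Matrix (Σ i, Fin (n i)) (Σ i, Fin (n i)) ℂ)

theorem eval_detRep (z : Fin d → ℂ) : eval z (detRep n K) = (1 - K * blockDiag n z).det := by
  simp only [detRep, RingHom.map_det, RingHom.mapMatrix_apply, Matrix.map_sub _ (map_sub _),
    Matrix.map_mul, Matrix.map_one _ (map_zero _) (map_one _), map_C_map_eval, map_blockDiag,
    eval_X]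

theorem eval_det_blockDiag_sub (z : Fin d → ℂ) :
    eval z (blockDiag n X - K.map C).det = (blockDiag n z - K).det := by
  simp only [RingHom.map_det, RingHom.mapMatrix_apply, Matrix.map_sub _ (map_sub _),
    map_C_map_eval, map_blockDiag, eval_X]

theorem multiDegree_detRep_le : multiDegree (detRep n K) ≤ n := fun i => by
  have hentry : ∀ a b, degreeOf i ((1 - K.map C * blockDiag n X : Matrix _ _ _) a b) ≤
      if b.1 = i then 1 else 0 := fun a b => by
    rw [Matrix.sub_apply, blockDiag, mul_diagonal, map_apply]
    refine (degreeOf_sub_le _ _ _).trans (max_le ?_ ?_)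
    · rw [one_apply]
      split_ifs <;> simp
    · refine (degreeOf_mul_le _ _ _).trans ?_
      rw [degreeOf_C, zero_add, degreeOf_X]
      simp only [eq_comm, le_refl]
  refine (degreeOf_det_le i hentry).trans_eq ?_
  rw [Fintype.sum_sigma]
  simp [apply_ite Finset.card]

theorem reflection_detRep :
    reflection n (detRep n K) = (blockDiag n X - Kᴴ.map C).det := by
  refine reflection_eq_of_eval (multiDegree_detRep_le n K) fun z hz => ?_
  have hinv : blockDiag n z * (blockDiag n fun i => star (1 / z i))ᴴ = 1 := by
    simp [blockDiag, hz, Pi.star_def]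
  have hfactor : blockDiag n z - Kᴴ =
      blockDiag n z * (1 - K * blockDiag n fun i => star (1 / z i))ᴴ := by
    rw [conjTranspose_sub, conjTranspose_one, conjTranspose_mul, mul_sub, mul_one, ← mul_assoc,
      hinv, one_mul]
  rw [eval_detRep, ← det_blockDiag, ← det_conjTranspose, ← det_mul, ← hfactor,
    eval_det_blockDiag_sub]

theorem eval_reflection_detRep (z : Fin d → ℂ) :
    eval z (reflection n (detRep n K)) = (blockDiag n z - Kᴴ).det := by
  rw [reflection_detRep, eval_det_blockDiag_sub]

variable {n K}

theorem IsContraction.reflectionQuotient_detRep (hK : IsContraction K) {z : Fin d → ℂ}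
    (hz : eval z (detRep n K) ≠ 0) :
    reflectionQuotient n (detRep n K) z = (juliaTransform K (blockDiag n z)).det := by
  rw [reflectionQuotient, div_eq_iff hz, eval_reflection_detRep]
  rw [eval_detRep] at hz ⊢
  rw [mul_comm, hK.det_one_sub_mul_mul_det_juliaTransform hz.isUnit]

open scoped Matrix.Norms.L2Operator in
theorem IsContraction.isSemiStable (hK : IsContraction K) : IsSemiStable (detRep n K) :=
  fun z hz => by
  have hZ : ‖blockDiag n z‖ < 1 := by
    rw [blockDiag, l2_opNorm_diagonal]
    exact (pi_norm_lt_iff one_pos).2 fun a => hz a.1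
  have hlt : ‖K * blockDiag n z‖ < 1 :=
    (norm_mul_le _ _).trans_lt (mul_lt_one_of_nonneg_of_lt_one_right hK (norm_nonneg _) hZ)
  rw [eval_detRep]
  exact ((isUnit_iff_isUnit_det _).1 (isUnit_one_sub_of_norm_lt_one hlt)).ne_zero

theorem actsContractively_blockDiag {S H : Type*} [CommRing S] [NormedAddCommGroup H] [Module S H]
    {x : Fin d → S} (hx : ∀ i, ∀ h : H, ‖x i • h‖ ≤ ‖h‖) :
    ActsContractively H (blockDiag n x) := fun v => by
  simp only [blockDiag, diagonal_apply, ite_smul, zero_smul, Finset.sum_ite_eq,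
    Finset.mem_univ, if_true]
  gcongr with a
  exact hx a.1 _

theorem IsContraction.norm_reflectionQuotient_detRep_le (hK : IsContraction K) {z : Fin d → ℂ}
    (hz : z ∈ polydisk d) : ‖reflectionQuotient n (detRep n K) z‖ ≤ 1 := by
  have hp := hK.isSemiStable z hz
  rw [hK.reflectionQuotient_detRep hp]
  rw [eval_detRep] at hp
  have hZ : ActsContractively ℂ (blockDiag n z) := actsContractively_blockDiag fun i h => by
    rw [norm_smul]
    exact mul_le_of_le_one_left (norm_nonneg h) (hz i).le
  have hdet := (hK.actsContractively_juliaTransform hZ hp.isUnit).norm_det_smul_le 1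
  simpa using hdet

end DetRep

section RationalInner

theorem exists_polynomial_eval_eq_eval_mul {σ R : Type*} [CommRing R] (p : MvPolynomial σ R)
    (w : σ → R) : ∃ q : Polynomial R, ∀ t, q.eval t = eval (fun i => w i * t) p :=
  ⟨aeval (fun i => Polynomial.C (w i) * Polynomial.X) p, fun t => by
    rw [← Polynomial.coe_aeval_eq_eval, comp_aeval_apply, ← aeval_eq_eval]
    simp⟩

theorem countable_setOf_eval_exp_mul_I_eq_zero {q : Polynomial ℂ} (hq : q ≠ 0) :
    {t : ℝ | q.eval (Complex.exp (t * Complex.I)) = 0}.Countable := by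
  have hroots : {w | q.eval w = 0}.Finite := by
    simpa [Polynomial.IsRoot] using Polynomial.finite_setOfPred_isRoot hq
  exact hroots.countable.preimage_cexp.preimage_of_injOn (f := fun t : ℝ => (t * Complex.I : ℂ))
    fun a _ b _ h => by simpa using h

/- On every line in the direction `(1, …, 1)` the point `(exp (iθ₁), …, exp (iθ_d))` runs through a
circle `w ↦ (c₁ w, …, c_d w)`, along which `p` restricts to a one-variable polynomial. -/
theorem ae_eval_exp_mul_I_ne_zero {σ : Type*} [Fintype σ] {p : MvPolynomial σ ℂ}
    (hp : eval 0 p ≠ 0) :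
    ∀ᵐ θ : σ → ℝ, eval (fun i => Complex.exp (θ i * Complex.I)) p ≠ 0 := by
  have hcont : Continuous fun θ : σ → ℝ => eval (fun i => Complex.exp (θ i * Complex.I)) p :=
    (MvPolynomial.continuous_eval p).comp (by fun_prop)
  let diag : ℝ →ₗ[ℝ] (σ → ℝ) := LinearMap.pi fun _ => LinearMap.id
  refine MeasureTheory.ae_mem_of_ae_add_linearMap_mem (μ := MeasureTheory.volume) diag
    MeasureTheory.volume (s := {θ | eval (fun i => Complex.exp (θ i * Complex.I)) p ≠ 0})
    (isOpen_ne.preimage hcont).measurableSet fun θ => ?_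
  obtain ⟨q, hq⟩ := exists_polynomial_eval_eq_eval_mul p fun i => Complex.exp (θ i * Complex.I)
  have hq0 : q ≠ 0 := by
    rintro rfl
    exact hp (by simpa [Pi.zero_def] using (hq 0).symm)
  filter_upwards [(countable_setOf_eval_exp_mul_I_eq_zero hq0).ae_notMem MeasureTheory.volume]
    with t ht
  simpa [hq, diag, add_mul, Complex.exp_add] using ht

variable {d : ℕ} {n : Fin d → ℕ} {p : MvPolynomial (Fin d) ℂ}

theorem IsSemiStable.analyticOnNhd_reflectionQuotient (hp : IsSemiStable p) (n : Fin d → ℕ) :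
    AnalyticOnNhd ℂ (reflectionQuotient n p) (polydisk d) :=
  ((AnalyticOnNhd.eval_mvPolynomial _).mono (Set.subset_univ _)).div
    ((AnalyticOnNhd.eval_mvPolynomial _).mono (Set.subset_univ _)) hp

theorem IsSemiStable.isRationalInner_reflectionQuotient (hp : IsSemiStable p)
    (hn : multiDegree p ≤ n) (hle : ∀ z ∈ polydisk d, ‖reflectionQuotient n p z‖ ≤ 1) :
    IsRationalInner (reflectionQuotient n p) := by
  refine ⟨⟨_, _, fun z hz => ⟨hp z hz, rfl⟩⟩, hp.analyticOnNhd_reflectionQuotient n, hle, ?_⟩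
  filter_upwards [ae_eval_exp_mul_I_ne_zero (hp 0 fun i => by simp)] with θ hθ
  refine ⟨_, norm_reflectionQuotient_eq_one hn (fun i => Complex.norm_exp_ofReal_mul_I _) hθ, ?_⟩
  have hquot : ContinuousAt (reflectionQuotient n p) fun i => Complex.exp (θ i * Complex.I) :=
    (MvPolynomial.continuous_eval _).continuousAt.div
      (MvPolynomial.continuous_eval _).continuousAt hθ
  have hradius : Continuous fun r : ℝ => fun i => (r : ℂ) * Complex.exp (θ i * Complex.I) := by
    fun_prop
  refine hquot.tendsto.comp (Filter.Tendsto.mono_left ?_ nhdsWithin_le_nhds)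
  simpa using hradius.tendsto 1

end RationalInner

end Polynomials

section TuplePow

/-- The monomial `a₁^{k₁} ⋯ a_d^{k_d}`, multiplied in this order. For a tuple of operators this is
`operatorPow`. -/
def tuplePow {A : Type*} [Monoid A] {d : ℕ} (a : Fin d → A) (k : Fin d → ℕ) : A :=
  (List.ofFn fun i => a i ^ k i).prod

theorem tuplePow_succ {A : Type*} [Monoid A] {d : ℕ} (a : Fin (d + 1) → A) (k : Fin (d + 1) → ℕ) :
    tuplePow a k = a 0 ^ k 0 * tuplePow (fun i => a i.succ) fun i => k i.succ := by
  rw [tuplePow, List.ofFn_succ, List.prod_cons, tuplePow]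

theorem tuplePow_zero {A : Type*} [Monoid A] {d : ℕ} (a : Fin d → A) : tuplePow a 0 = 1 := by
  simp [tuplePow]

theorem tuplePow_eq_prod {A : Type*} [CommMonoid A] {d : ℕ} (a : Fin d → A) (k : Fin d → ℕ) :
    tuplePow a k = ∏ i, a i ^ k i :=
  List.prod_ofFn

theorem tuplePow_single {A : Type*} [Monoid A] {d : ℕ} (a : Fin d → A) (i : Fin d) :
    tuplePow a (Pi.single i 1) = a i := by
  induction d with
  | zero => exact i.elim0
  | succ d ih =>
    rw [tuplePow_succ]
    induction i using Fin.cases with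
    | zero =>
      simpa [Pi.zero_def] using congrArg (a 0 * ·) (tuplePow_zero fun i : Fin d => a i.succ)
    | succ i =>
      have hsingle : (fun j : Fin d => (Pi.single i.succ 1 : Fin (d + 1) → ℕ) j.succ) =
          Pi.single i 1 := funext fun j => by simp [Pi.single_apply]
      simpa [hsingle] using ih (fun j => a j.succ) i

theorem tuplePow_add {A : Type*} [Monoid A] {d : ℕ} {a : Fin d → A}
    (ha : ∀ i j, Commute (a i) (a j)) (k l : Fin d → ℕ) :
    tuplePow a (k + l) = tuplePow a k * tuplePow a l := by
  induction d with
  | zero => simp [tuplePow]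
  | succ d ih =>
    have hcomm : Commute (a 0 ^ l 0) (tuplePow (fun i => a i.succ) fun i => k i.succ) := by
      refine Commute.list_prod_right _ _ fun x hx => ?_
      obtain ⟨i, rfl⟩ := List.mem_ofFn.1 hx
      exact (ha _ _).pow_pow _ _
    have htail := ih (a := fun i => a i.succ) (fun i j => ha _ _) (fun i => k i.succ) fun i =>
      l i.succ
    simp only [tuplePow_succ, Pi.add_apply, pow_add]
    calc _ = a 0 ^ k 0 * a 0 ^ l 0 * ((tuplePow (fun i => a i.succ) fun i => k i.succ) *
          tuplePow (fun i => a i.succ) fun i => l i.succ) := by rw [← htail]; rfl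
      _ = _ := by simp only [mul_assoc, hcomm.left_comm]

theorem norm_pow_mul_le {A : Type*} [SeminormedRing A] (a b : A) (m : ℕ) :
    ‖a ^ m * b‖ ≤ ‖a‖ ^ m * ‖b‖ := by
  induction m with
  | zero => simp
  | succ m ih =>
    rw [pow_succ', pow_succ', mul_assoc, mul_assoc]
    exact (norm_mul_le _ _).trans (by gcongr)

theorem norm_tuplePow_le {A : Type*} [SeminormedRing A] {d : ℕ} {a : Fin d → A} {r : ℝ}
    (ha : ∀ i, ‖a i‖ ≤ r) (k : Fin d → ℕ) : ‖tuplePow a k‖ ≤ ‖(1 : A)‖ * r ^ ∑ i, k i := by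
  induction d with
  | zero => simp [tuplePow]
  | succ d ih =>
    rw [tuplePow_succ, Fin.sum_univ_succ, pow_add, mul_left_comm]
    refine (norm_pow_mul_le _ _ _).trans ?_
    have hr : 0 ≤ r := (norm_nonneg _).trans (ha 0)
    gcongr
    · exact ha 0
    · exact ih (fun i => ha i.succ) _

end TuplePow

section ConvergentSeries

open MvPowerSeries Finset

theorem summable_pow_degree {σ : Type*} [Finite σ] {r : ℝ} (h0 : 0 ≤ r) (h1 : r < 1) :
    Summable fun k : σ →₀ ℕ => r ^ k.degree := by
  classical
  have := Fintype.ofFinite σ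
  refine summable_of_sum_le (c := ∏ _i : σ, ∑' j, r ^ j) (fun k => by positivity) fun s => ?_
  let M := s.sup Finsupp.degree
  calc ∑ k ∈ s, r ^ k.degree
      = ∑ k ∈ s.map ⟨_, DFunLike.coe_injective⟩, ∏ i, r ^ k i := by
        simp [prod_pow_eq_pow_sum, Finsupp.degree_eq_sum]
    _ ≤ ∑ k ∈ Fintype.piFinset fun _ => range (M + 1), ∏ i, r ^ k i := by
        refine sum_le_sum_of_subset_of_nonneg (fun k hk => ?_) fun k _ _ => by positivity
        obtain ⟨l, hl, rfl⟩ := mem_map.1 hk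
        exact Fintype.mem_piFinset.2 fun i =>
          mem_range_succ_iff.2 ((Finsupp.le_degree i l).trans (le_sup hl))
    _ = ∏ _i : σ, ∑ j ∈ range (M + 1), r ^ j := (prod_univ_sum _ _).symm
    _ ≤ ∏ _i : σ, ∑' j, r ^ j :=
        prod_le_prod (fun i _ => by positivity) fun i _ =>
          (summable_geometric_of_lt_one h0 h1).sum_le_tsum _ fun j _ => by positivity

theorem summable_norm_coeff_mul_mul_pow {σ R : Type*} [SeminormedRing R] {φ ψ : MvPowerSeries σ R}
    {r : ℝ} (h0 : 0 ≤ r) (hφ : Summable fun k => ‖coeff k φ‖ * r ^ k.degree)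
    (hψ : Summable fun k => ‖coeff k ψ‖ * r ^ k.degree) :
    Summable fun k => ‖coeff k (φ * ψ)‖ * r ^ k.degree := by
  classical
  have hpos : ∀ (χ : MvPowerSeries σ R) (k : σ →₀ ℕ), 0 ≤ ‖coeff k χ‖ * r ^ k.degree :=
    fun χ k => by positivity
  have hcauchy := summable_sum_mul_antidiagonal_of_summable_mul
    (Summable.mul_of_nonneg hφ hψ (hpos φ) (hpos ψ))
  refine hcauchy.of_nonneg_of_le (hpos _) fun k => ?_
  rw [coeff_mul]
  calc ‖∑ x ∈ antidiagonal k, coeff x.1 φ * coeff x.2 ψ‖ * r ^ k.degree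
      ≤ (∑ x ∈ antidiagonal k, ‖coeff x.1 φ‖ * ‖coeff x.2 ψ‖) * r ^ k.degree := by
        gcongr
        exact norm_sum_le_of_le _ fun x _ => norm_mul_le _ _
    _ = ∑ x ∈ antidiagonal k,
          ‖coeff x.1 φ‖ * r ^ x.1.degree * (‖coeff x.2 ψ‖ * r ^ x.2.degree) := by
        rw [sum_mul]
        refine sum_congr rfl fun x hx => ?_
        rw [← mem_antidiagonal.1 hx, map_add, pow_add]
        ring

/-- The algebra of power series which converge absolutely on the open unit polydisk. -/
def convergentSeries (σ 𝕜 : Type*) [NormedField 𝕜] : Subalgebra 𝕜 (MvPowerSeries σ 𝕜) where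
  carrier := {φ | ∀ r : ℝ, 0 ≤ r → r < 1 → Summable fun k => ‖coeff k φ‖ * r ^ k.degree}
  add_mem' {φ ψ} hφ hψ r h0 h1 := by
    refine ((hφ r h0 h1).add (hψ r h0 h1)).of_nonneg_of_le (fun k => by positivity) fun k => ?_
    rw [map_add, ← add_mul]
    gcongr
    exact norm_add_le _ _
  mul_mem' {φ ψ} hφ hψ r h0 h1 :=
    summable_norm_coeff_mul_mul_pow h0 (hφ r h0 h1) (hψ r h0 h1)
  algebraMap_mem' a r _ _ := by
    classical
    refine summable_of_ne_finset_zero (s := {0}) fun k hk => ?_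
    rw [MvPowerSeries.algebraMap_apply, coeff_C, if_neg (by simpa using hk), norm_zero, zero_mul]

theorem mem_convergentSeries_of_norm_coeff_le {σ 𝕜 : Type*} [Finite σ] [NormedField 𝕜]
    {φ : MvPowerSeries σ 𝕜} {M : ℝ} (hφ : ∀ k, ‖coeff k φ‖ ≤ M) : φ ∈ convergentSeries σ 𝕜 :=
  fun r h0 h1 =>
    ((summable_pow_degree h0 h1).mul_left M).of_nonneg_of_le (fun k => by positivity) fun k => by
      gcongr
      exact hφ k

theorem X_mem_convergentSeries {σ 𝕜 : Type*} [NormedField 𝕜] (i : σ) :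
    X i ∈ convergentSeries σ 𝕜 := fun r _ _ => by
  classical
  refine summable_of_ne_finset_zero (s := {Finsupp.single i 1}) fun k hk => ?_
  rw [coeff_X, if_neg (by simpa using hk), norm_zero, zero_mul]

/-- The variables as elements of the algebra of convergent power series. -/
noncomputable def varSeries {σ : Type*} (𝕜 : Type*) [NormedField 𝕜] (i : σ) :
    convergentSeries σ 𝕜 :=
  ⟨X i, X_mem_convergentSeries i⟩

variable {d : ℕ} {𝕜 A : Type*} [NormedField 𝕜] [NormedRing A] [NormedAlgebra 𝕜 A] {a : Fin d → A}

theorem summable_norm_coeff_smul_tuplePow (ha : ∀ i, ‖a i‖ < 1) (φ : convergentSeries (Fin d) 𝕜) :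
    Summable fun k => ‖coeff k φ.1 • tuplePow a k‖ := by
  let r := univ.sup fun i => ‖a i‖₊
  have h1 : r < 1 := (Finset.sup_lt_iff (by simp)).2 fun i _ => ha i
  have hr : ∀ i, ‖a i‖ ≤ (r : ℝ) := fun i => Finset.le_sup (f := fun i => ‖a i‖₊) (mem_univ i)
  refine ((φ.2 r r.2 h1).mul_left ‖(1 : A)‖).of_nonneg_of_le (fun k => norm_nonneg _) fun k => ?_
  rw [norm_smul, Finsupp.degree_eq_sum, mul_left_comm]
  gcongr
  exact norm_tuplePow_le hr k

variable [CompleteSpace A]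

theorem tsum_coeff_mul_smul_tuplePow (hc : ∀ i j, Commute (a i) (a j))
    {φ ψ : MvPowerSeries (Fin d) 𝕜} (hφ : Summable fun k => ‖coeff k φ • tuplePow a k‖)
    (hψ : Summable fun k => ‖coeff k ψ • tuplePow a k‖) :
    ∑' k, coeff k (φ * ψ) • tuplePow a k =
      (∑' k, coeff k φ • tuplePow a k) * ∑' k, coeff k ψ • tuplePow a k := by
  have hmul := summable_mul_of_summable_norm hφ hψ
  have hcauchy := hφ.of_norm.tsum_mul_tsum_eq_tsum_sum_antidiagonal hψ.of_norm hmul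
  rw [hcauchy]
  refine tsum_congr fun k => ?_
  rw [coeff_mul, sum_smul]
  refine sum_congr rfl fun x hx => ?_
  rw [← mem_antidiagonal.1 hx, Finsupp.coe_add, tuplePow_add hc, smul_mul_smul_comm]

/-- Evaluation of convergent power series at a tuple of commuting elements of norm less than one of
a Banach algebra: `φ ↦ ∑ₖ φₖ a^k`. -/
noncomputable def evalSeries (a : Fin d → A) (hc : ∀ i j, Commute (a i) (a j))
    (ha : ∀ i, ‖a i‖ < 1) : convergentSeries (Fin d) 𝕜 →ₐ[𝕜] A :=
  AlgHom.ofLinearMap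
    { toFun φ := ∑' k, coeff k φ.1 • tuplePow a k
      map_add' φ ψ := by
        simp only [Subalgebra.coe_add, map_add, add_smul]
        exact (summable_norm_coeff_smul_tuplePow ha φ).of_norm.tsum_add
          (summable_norm_coeff_smul_tuplePow ha ψ).of_norm
      map_smul' c φ := by
        simp only [Subalgebra.coe_smul, map_smul, smul_assoc, RingHom.id_apply]
        exact (summable_norm_coeff_smul_tuplePow ha φ).of_norm.tsum_const_smul c }
    (by
      change ∑' k, coeff k 1 • tuplePow a k = 1
      rw [tsum_eq_single 0 fun k hk => by rw [coeff_one, if_neg hk, zero_smul]]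
      simp [tuplePow_zero])
    fun φ ψ => tsum_coeff_mul_smul_tuplePow hc (summable_norm_coeff_smul_tuplePow ha φ)
      (summable_norm_coeff_smul_tuplePow ha ψ)

variable (hc : ∀ i j, Commute (a i) (a j)) (ha : ∀ i, ‖a i‖ < 1)

theorem hasSum_evalSeries (φ : convergentSeries (Fin d) 𝕜) :
    HasSum (fun k : Fin d →₀ ℕ => coeff k φ.1 • tuplePow a k) (evalSeries a hc ha φ) :=
  (summable_norm_coeff_smul_tuplePow ha φ).of_norm.hasSum

theorem hasSum_evalSeries_equivFunOnFinite (φ : convergentSeries (Fin d) 𝕜) :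
    HasSum (fun k => coeff (Finsupp.equivFunOnFinite.symm k) φ.1 • tuplePow a k)
      (evalSeries a hc ha φ) := by
  have hsum := Finsupp.equivFunOnFinite.symm.hasSum_iff.2 (hasSum_evalSeries hc ha φ)
  simpa only [Function.comp_def, Finsupp.coe_equivFunOnFinite_symm] using hsum

theorem evalSeries_varSeries (i : Fin d) : evalSeries a hc ha (varSeries 𝕜 i) = a i := by
  refine (hasSum_evalSeries hc ha (varSeries 𝕜 i)).unique ?_
  have hsum := hasSum_single (f := fun k => coeff k (X i : MvPowerSeries (Fin d) 𝕜) • tuplePow a k)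
    (Finsupp.single i 1) fun k hk => by rw [coeff_X, if_neg hk, zero_smul]
  rwa [coeff_X, if_pos rfl, one_smul, Finsupp.single_eq_pi_single, tuplePow_single] at hsum

end ConvergentSeries

section Resolvent

open MvPowerSeries Finset
open Matrix hiding blockDiag blockDiag_map

section

variable {ι : Type*} [Fintype ι] [DecidableEq ι]

theorem isUnit_det_one_sub_mul_diagonal_X {σ R : Type*} [CommRing R]
    (A : Matrix ι ι (MvPowerSeries σ R)) (s : ι → σ) :
    IsUnit (1 - A * diagonal fun a => X (s a)).det := by
  have hX : (diagonal fun a => (X (s a) : MvPowerSeries σ R)).map constantCoeff = 0 := by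
    simp [diagonal_map (map_zero _)]
  rw [isUnit_iff_constantCoeff, RingHom.map_det, RingHom.mapMatrix_apply,
    Matrix.map_sub _ (map_sub _), Matrix.map_mul, hX, mul_zero, sub_zero,
    Matrix.map_one _ (map_zero _) (map_one _), det_one]
  exact isUnit_one

theorem mem_finsuppAntidiag_univ_iff_degree {σ : Type*} [Fintype σ] [DecidableEq σ]
    {k : σ →₀ ℕ} {m : ℕ} :
    k ∈ finsuppAntidiag univ m ↔ k.degree = m := by
  simp [mem_finsuppAntidiag, Finsupp.degree_eq_sum]

theorem sum_finsuppAntidiag_succ_coeff_X_mul {σ : Type*} [Fintype σ] [DecidableEq σ]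
    {R M : Type*} [Semiring R] [AddCommMonoid M] {f : R → M} (hf : f 0 = 0)
    (φ : MvPowerSeries σ R) (i : σ) (m : ℕ) :
    ∑ k ∈ finsuppAntidiag univ (m + 1), f (coeff k (X i * φ)) =
      ∑ k ∈ finsuppAntidiag univ m, f (coeff k φ) := by
  refine (sum_of_injOn (Finsupp.single i 1 + ·) (add_right_injective _).injOn (fun k hk => ?_)
    (fun k hk hrange => ?_) fun k _ => ?_).symm
  · simp only [mem_coe, mem_finsuppAntidiag_univ_iff_degree] at hk ⊢
    rw [map_add, Finsupp.degree_single, hk, add_comm]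
  · rw [X, coeff_monomial_mul, if_neg, hf]
    intro hle
    rw [mem_finsuppAntidiag_univ_iff_degree, ← add_tsub_cancel_of_le hle, map_add,
      Finsupp.degree_single, add_comm, Nat.add_right_cancel_iff] at hk
    exact hrange ⟨k - Finsupp.single i 1, mem_finsuppAntidiag_univ_iff_degree.2 hk,
      add_tsub_cancel_of_le hle⟩
  · rw [X, coeff_add_monomial_mul, one_mul]

variable {K : Matrix ι ι ℂ}

theorem IsContraction.sum_norm_sq_coeff_le (hK : IsContraction K) {σ : Type*} [Fintype σ]
    [DecidableEq σ] {s : ι → σ} {u : ι → ℂ} {x : ι → MvPowerSeries σ ℂ}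
    (hx : ∀ a, x a = C (u a) + ∑ c, C (K a c) * (X (s c) * x c)) (m : ℕ) :
    ∑ k ∈ finsuppAntidiag univ m, ∑ a, ‖coeff k (x a)‖ ^ 2 ≤ ∑ a, ‖u a‖ ^ 2 := by
  have hcoeff : ∀ k a, coeff k (x a) =
      coeff k (C (u a)) + (K *ᵥ fun c => coeff k (X (s c) * x c)) a := fun k a => by
    conv_lhs => rw [hx, map_add, map_sum]
    simp only [coeff_C_mul, mulVec, dotProduct]
  induction m with
  | zero =>
    have hzero : ∀ a, coeff 0 (x a) = u a := fun a => by
      rw [hx, map_add, map_sum]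
      simp
    rw [finsuppAntidiag_zero, sum_singleton]
    simp only [hzero, le_refl]
  | succ m ih =>
    calc ∑ k ∈ finsuppAntidiag univ (m + 1), ∑ a, ‖coeff k (x a)‖ ^ 2
        ≤ ∑ k ∈ finsuppAntidiag univ (m + 1), ∑ c, ‖coeff k (X (s c) * x c)‖ ^ 2 := by
          refine sum_le_sum fun k hk => ?_
          have hk0 : k ≠ 0 := by
            rintro rfl
            simp at hk
          simpa only [hcoeff, coeff_C, if_neg hk0, zero_add] using
            hK.sum_norm_sq_mulVec_le fun c => coeff k (X (s c) * x c)
      _ = ∑ k ∈ finsuppAntidiag univ m, ∑ a, ‖coeff k (x a)‖ ^ 2 := by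
          rw [sum_comm, sum_comm (s := finsuppAntidiag univ m)]
          exact sum_congr rfl fun c _ =>
            sum_finsuppAntidiag_succ_coeff_X_mul (f := (‖·‖ ^ 2)) (by simp) (x c) (s c) m
      _ ≤ ∑ a, ‖u a‖ ^ 2 := ih

theorem IsContraction.norm_coeff_inv_le (hK : IsContraction K) {σ : Type*} [Finite σ] (s : ι → σ)
    (k : σ →₀ ℕ) (a b : ι) :
    ‖coeff k ((1 - K.map C * diagonal fun a => X (s a) : Matrix ι ι _)⁻¹ a b)‖ ≤ 1 := by
  classical
  have := Fintype.ofFinite σ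
  set R := (1 - K.map C * diagonal fun a => (X (s a) : MvPowerSeries σ ℂ))⁻¹
  have hR : R = 1 + K.map C * (diagonal (fun a => X (s a)) * R) := by
    rw [← sub_eq_iff_eq_add, ← mul_assoc, ← one_sub_mul]
    exact mul_nonsing_inv _ (isUnit_det_one_sub_mul_diagonal_X _ s)
  have hcolumn : ∀ a, R a b = C ((1 : Matrix ι ι ℂ) a b) + ∑ c, C (K a c) * (X (s c) * R c b) :=
    fun a => by
      conv_lhs => rw [hR, Matrix.add_apply, mul_apply]
      simp only [one_apply, apply_ite C, map_one, map_zero, map_apply, diagonal_mul]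
  have hunit : ∑ a, ‖(1 : Matrix ι ι ℂ) a b‖ ^ 2 = 1 := by
    simp [one_apply, apply_ite norm]
  refine (sq_le_one_iff₀ (norm_nonneg _)).1 ?_
  calc ‖coeff k (R a b)‖ ^ 2 ≤ ∑ a, ‖coeff k (R a b)‖ ^ 2 :=
        single_le_sum (f := fun a => ‖coeff k (R a b)‖ ^ 2) (fun _ _ => by positivity) (mem_univ a)
    _ ≤ ∑ k ∈ finsuppAntidiag univ k.degree, ∑ a, ‖coeff k (R a b)‖ ^ 2 :=
        single_le_sum (f := fun k => ∑ a, ‖coeff k (R a b)‖ ^ 2) (fun _ _ => by positivity)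
          (mem_finsuppAntidiag_univ_iff_degree.2 rfl)
    _ ≤ 1 := (hK.sum_norm_sq_coeff_le hcolumn _).trans_eq hunit

end

variable {d : ℕ} {n : Fin d → ℕ} {K : Matrix (Σ i, Fin (n i)) (Σ i, Fin (n i)) ℂ}

theorem IsContraction.isUnit_det_one_sub_mul_blockDiag_varSeries (hK : IsContraction K) :
    IsUnit (1 - K.map (algebraMap ℂ (convergentSeries (Fin d) ℂ)) *
      blockDiag n (varSeries ℂ)).det := by
  let formal : Matrix _ _ (MvPowerSeries (Fin d) ℂ) := 1 - K.map C * blockDiag n X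
  let resolvent : Matrix (Σ i, Fin (n i)) (Σ i, Fin (n i)) (convergentSeries (Fin d) ℂ) :=
    of fun a b => ⟨formal⁻¹ a b,
      mem_convergentSeries_of_norm_coeff_le fun k => hK.norm_coeff_inv_le (·.1) k a b⟩
  let incl := (convergentSeries (Fin d) ℂ).val.toRingHom
  have hinv : formal * resolvent.map incl = 1 :=
    mul_nonsing_inv _ (isUnit_det_one_sub_mul_diagonal_X _ _)
  refine isUnit_det_of_right_inverse (B := resolvent)
    (Matrix.map_injective (f := incl) Subtype.val_injective ?_)
  simp only [Matrix.map_mul, Matrix.map_sub _ (map_sub _),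
    Matrix.map_one _ (map_zero _) (map_one _), map_blockDiag]
  exact hinv

end Resolvent

section SchurAgler

variable {d : ℕ} {n : Fin d → ℕ} {K : Matrix (Σ i, Fin (n i)) (Σ i, Fin (n i)) ℂ}

/-- The determinant of the Julia transform of `Z_n`, as a convergent power series in the variables
`z₁, …, z_d`. It is the power series of `z^n p̄(1/z) / p(z)` for `p = det (1 - K Z_n)`. -/
noncomputable def juliaSeries (n : Fin d → ℕ) (K : Matrix (Σ i, Fin (n i)) (Σ i, Fin (n i)) ℂ) :
    convergentSeries (Fin d) ℂ :=
  (juliaTransform K (blockDiag n (varSeries ℂ))).det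

theorem IsContraction.evalSeries_juliaSeries (hK : IsContraction K) {z : Fin d → ℂ}
    (hz : z ∈ polydisk d) :
    evalSeries z (fun _ _ => Commute.all _ _) hz (juliaSeries n K) =
      reflectionQuotient n (detRep n K) z := by
  rw [hK.reflectionQuotient_detRep (hK.isSemiStable z hz), juliaSeries, AlgHom.map_det,
    AlgHom.mapMatrix_apply, map_juliaTransform _ hK.isUnit_det_one_sub_mul_blockDiag_varSeries]
  congr 2
  refine (map_blockDiag n (evalSeries z _ hz : convergentSeries (Fin d) ℂ →ₐ[ℂ] ℂ).toRingHom
    (varSeries ℂ)).trans (congrArg _ (funext fun i => evalSeries_varSeries _ hz i))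

theorem IsContraction.norm_evalSeries_juliaSeries_le (hK : IsContraction K) {H : Type*}
    [NormedAddCommGroup H] [InnerProductSpace ℂ H] [CompleteSpace H] {T : Fin d → H →L[ℂ] H}
    (hc : ∀ i j, Commute (T i) (T j)) (hT : ∀ i, ‖T i‖ < 1) :
    ‖evalSeries T hc hT (juliaSeries n K)‖ ≤ 1 := by
  let π : convergentSeries (Fin d) ℂ →ₐ[ℂ] H →L[ℂ] H := evalSeries T hc hT
  let _ : Module (convergentSeries (Fin d) ℂ) H := Module.compHom H π.toRingHom
  have : IsScalarTower ℂ (convergentSeries (Fin d) ℂ) H := ⟨fun c φ h =>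
    congrArg (fun A : H →L[ℂ] H => A h) (map_smul π c φ)⟩
  have hvar : ∀ i, ∀ h : H, ‖varSeries ℂ i • h‖ ≤ ‖h‖ := fun i h => by
    change ‖π (varSeries ℂ i) h‖ ≤ ‖h‖
    rw [evalSeries_varSeries]
    exact ((T i).le_of_opNorm_le (hT i).le h).trans_eq (one_mul _)
  have hact : ActsContractively H (juliaTransform K (blockDiag n (varSeries ℂ))) :=
    hK.actsContractively_juliaTransform (actsContractively_blockDiag hvar)
      hK.isUnit_det_one_sub_mul_blockDiag_varSeries
  let _ : NormedSpace ℝ H := NormedSpace.restrictScalars ℝ ℂ H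
  exact ContinuousLinearMap.opNorm_le_bound _ zero_le_one fun h =>
    (hact.norm_det_smul_le h).trans_eq (one_mul _).symm

theorem IsContraction.isSchurAgler (hK : IsContraction K) :
    IsSchurAgler.{u} (reflectionQuotient n (detRep n K)) := by
  refine ⟨hK.isSemiStable.analyticOnNhd_reflectionQuotient n,
    fun k => MvPowerSeries.coeff (Finsupp.equivFunOnFinite.symm k) (juliaSeries n K).1,
    fun z hz => ?_, fun H _ _ _ T hc hT => ⟨evalSeries T hc hT (juliaSeries n K), ?_,
      hK.norm_evalSeries_juliaSeries_le hc hT⟩⟩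
  · rw [← hK.evalSeries_juliaSeries hz]
    simpa only [tuplePow_eq_prod, smul_eq_mul] using
      hasSum_evalSeries_equivFunOnFinite (fun _ _ => Commute.all _ _) hz (juliaSeries n K)
  · exact hasSum_evalSeries_equivFunOnFinite hc hT (juliaSeries n K)

end SchurAgler

theorem mainTheorem2 {d : ℕ} (n : Fin d → ℕ) (p : MvPolynomial (Fin d) ℂ)
    (K : Matrix (Σ i, Fin (n i)) (Σ i, Fin (n i)) ℂ)
    (hK : IsContraction K) (hp : p = detRep n K) :
    (∀ z : Fin d → ℂ, MvPolynomial.eval z p ≠ 0 →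
      reflectionQuotient n p z = (transferMatrix n K z).det) ∧
    IsRationalInner (reflectionQuotient n p) ∧
    IsEventualAglerDenominator.{u} n p ∧
    (multiDegree p = n → IsAglerDenominator.{u} p) := by
  subst hp
  have hagler : IsEventualAglerDenominator n (detRep n K) :=
    ⟨hK.isSemiStable, multiDegree_detRep_le n K, hK.isSchurAgler⟩
  refine ⟨fun z hz => ?_, ?_, hagler, fun hdeg => ⟨hK.isSemiStable, ?_⟩⟩
  · rw [transferMatrix_eq_juliaTransform, hK.reflectionQuotient_detRep hz]
  · exact hK.isSemiStable.isRationalInner_reflectionQuotient (multiDegree_detRep_le n K)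
      fun z hz => hK.norm_reflectionQuotient_detRep_le hz
  · rw [hdeg]
    exact hK.isSchurAgler
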